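/- Let $r\ge 3$. An $r$-graph $H$ is a finite $r$-uniform hypergraph; $v(H)$ and $e(H)$ denote its numbers of vertices and edges. An $r$-graph is $2$-tightly connected if its edges can be ordered $e_1,\dots,e_t$ so that for each $2\le i\le t$ there is $1\le j<i$ with $|e_i\cap e_j|\ge 2$. An $r$-graph $G$ is homomorphic to an $r$-graph $F$ if there is a map $V(G)\to V(F)$ under which the image of every edge of $G$ is an edge of $F$. An $r$-graph is $F$-free if it has no (not necessarily induced) subgraph isomorphic to $F$. For $r$-graphs $F,G$ and an integer $n\ge 1$, let $f_{F,G}(n)$ be the maximum integer $m$ such that every $n$-vertex $G$-free $r$-graph contains an $F$-free induced subgraph on $m$ vertices. The $2$-shadow $\partial_2F$ is the graph on $V(F)$ whose edges are the pairs contained in some edge of $F$. Theorem 1.3. Let $r\ge 3$ and let $F$ be an $r$-graph with at least one edge. There exists a constant $c$ depending only on $F$ such that, for every $2$-tightly connected $r$-graph $G$ that is not homomorphic to $F$ and for all sufficiently large $n$, $$f_{F,G}(n)\le c(\log n)^{\alpha_F},\qquad\text{where}\qquad \alpha_F=\max_{F'}\frac{e(F')+1}{v(F')-1},$$ the maximum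 being over all subgraphs $F'$ of $\partial_2F$ with at least one edge. -/

import Mathlib

universe u v

namespace Hypergraph

/-- `H` is an `r`-graph: a finite hypergraph all of whose edges have exactly `r` vertices. -/
structure IsRGraph {α : Type*} (H : Hypergraph α) (r : ℕ) : Prop where
  finite_vertexSet : V(H).Finite
  ncard_edge : ∀ e ∈ E(H), e.ncard = r

/-- `H'` is a (not necessarily induced) subgraph of `H`. -/
def IsSubgraph {α : Type*} (H' H : Hypergraph α) : Prop :=
  V(H') ⊆ V(H) ∧ E(H') ⊆ E(H)

/-- The subgraph of `H` induced on the vertices lying in `S`. -/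
def induce {α : Type*} (H : Hypergraph α) (S : Set α) : Hypergraph α where
  vertexSet := V(H) ∩ S
  edgeSet := {e | e ∈ E(H) ∧ e ⊆ S}
  subset_vertexSet_of_mem_edgeSet' := fun _ he =>
    Set.subset_inter (H.subset_vertexSet_of_mem_edgeSet' he.1) he.2

/-- `G` is homomorphic to `F`: some map sends every vertex of `G` to a vertex of `F`
and every edge of `G` onto an edge of `F`. -/
def IsHomomorphicTo {α β : Type*} (G : Hypergraph α) (F : Hypergraph β) : Prop :=
  ∃ f : α → β, (∀ x ∈ V(G), f x ∈ V(F)) ∧ ∀ e ∈ E(G), f '' e ∈ E(F)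

/-- `H` contains a copy of `F` as a (not necessarily induced) subgraph. -/
def ContainsCopy {α β : Type*} (H : Hypergraph α) (F : Hypergraph β) : Prop :=
  ∃ f : β → α, Set.InjOn f V(F) ∧ (F.image f).IsSubgraph H

/-- `H` is `F`-free. -/
def IsFree {α β : Type*} (H : Hypergraph α) (F : Hypergraph β) : Prop :=
  ¬ H.ContainsCopy F

/-- `H` is `k`-tightly connected: its edges can be listed, each exactly once, so that every edge
but the first meets some earlier edge in at least `k` vertices. -/
def IsTightlyConnected {α : Type*} (k : ℕ) (H : Hypergraph α) : Prop :=
  ∃ (t : ℕ) (e : Fin t → Set α), Function.Injective e ∧ Set.range e = E(H) ∧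
    ∀ i : Fin t, 0 < (i : ℕ) → ∃ j : Fin t, j < i ∧ k ≤ (e i ∩ e j).ncard

/-- The `k`-shadow `∂ₖ H`: the `k`-graph whose edges are the `k`-subsets of the edges of `H`. -/
def kShadow {α : Type*} (k : ℕ) (H : Hypergraph α) : Hypergraph α where
  vertexSet := V(H)
  edgeSet := {S | ∃ e ∈ E(H), S ⊆ e ∧ S.ncard = k}
  subset_vertexSet_of_mem_edgeSet' := fun _ ⟨_, he, hS, _⟩ =>
    hS.trans (H.subset_vertexSet_of_mem_edgeSet' he)

/-- The numbers `(e(F') + 1) / (v(F') - 1)`, for `F'` a subgraph of `∂₂ F` with at least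
one edge (hence at least two vertices). -/
def densityValues {α : Type*} (F : Hypergraph α) : Set ℝ :=
  {x | ∃ F' : Hypergraph α, F'.IsSubgraph (F.kShadow 2) ∧ E(F').Nonempty ∧
    x = ((E(F').ncard : ℝ) + 1) / ((V(F').ncard : ℝ) - 1)}

/-- The exponent `α_F`; a maximum by `isGreatest_alpha`. -/
noncomputable def alpha {α : Type*} (F : Hypergraph α) : ℝ :=
  sSup F.densityValues

/-- The `m` such that every `G`-free `r`-graph on `n` vertices has an `F`-free induced subgraph
on exactly `m` vertices. -/
def erdosRogersSet {α β : Type*} (r : ℕ) (F : Hypergraph α) (G : Hypergraph β) (n : ℕ) : Set ℕ :=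
  {m | ∀ H : Hypergraph (Fin n), V(H) = Set.univ → H.IsRGraph r → H.IsFree G →
    ∃ S : Set (Fin n), S.ncard = m ∧ (H.induce S).IsFree F}

/-- The function `f_{F,G}(n)` for `r`-graphs; a maximum by `isGreatest_erdosRogers`. -/
noncomputable def erdosRogers {α β : Type*} (r : ℕ) (F : Hypergraph α) (G : Hypergraph β)
    (n : ℕ) : ℕ :=
  sSup (erdosRogersSet r F G n)

theorem isGreatest_alpha {α : Type*} {r : ℕ} (hr : 2 ≤ r) {F : Hypergraph α}
    (hF : F.IsRGraph r) (hE : E(F).Nonempty) : IsGreatest F.densityValues F.alpha := by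
  have hfin : F.densityValues.Finite := by
    have h1 : (V(F).powerset ×ˢ V(F).powerset.powerset).Finite :=
      hF.finite_vertexSet.powerset.prod hF.finite_vertexSet.powerset.powerset
    refine (h1.image (fun p : Set α × Set (Set α) =>
      ((p.2.ncard : ℝ) + 1) / ((p.1.ncard : ℝ) - 1))).subset ?_
    rintro x ⟨F', hF', -, rfl⟩
    refine ⟨(V(F'), E(F')), ⟨hF'.1, fun e he => ?_⟩, rfl⟩
    exact (F'.subset_vertexSet_of_mem_edgeSet' he).trans hF'.1
  have hne : F.densityValues.Nonempty := by
    obtain ⟨e, he⟩ := hE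
    obtain ⟨S, hS, hc⟩ := Set.exists_subset_card_eq (hr.trans (hF.ncard_edge e he).ge)
    exact ⟨_, F.kShadow 2, ⟨subset_rfl, subset_rfl⟩, ⟨S, e, he, hS, hc⟩, rfl⟩
  exact ⟨hne.csSup_mem hfin, fun x hx => le_csSup hfin.bddAbove hx⟩

theorem isGreatest_erdosRogers {α β : Type*} {r : ℕ} (hr : 1 ≤ r) {F : Hypergraph α}
    (hF : F.IsRGraph r) (hE : E(F).Nonempty) {G : Hypergraph β}
    (hGF : ¬ G.IsHomomorphicTo F) (n : ℕ) :
    IsGreatest (erdosRogersSet r F G n) (erdosRogers r F G n) := by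
  obtain ⟨e, he⟩ := hE
  have hne : e.Nonempty := Set.nonempty_of_ncard_ne_zero (by rw [hF.ncard_edge e he]; omega)
  obtain ⟨x, hx⟩ := hne
  have hxV : x ∈ V(F) := F.subset_vertexSet_of_mem_edgeSet' he hx
  have hGE : E(G).Nonempty := by
    by_contra h
    rw [Set.not_nonempty_iff_eq_empty] at h
    exact hGF ⟨fun _ => x, fun _ _ => hxV, fun e he => by simp [h] at he⟩
  have hb : ∀ m ∈ erdosRogersSet r F G n, m ≤ n := by
    intro m hm
    obtain ⟨S, rfl, -⟩ := hm (trivialOn Set.univ) rfl ⟨Set.toFinite _, fun e he => he.elim⟩ (by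
      rintro ⟨f, -, hf⟩
      obtain ⟨e', he'⟩ := hGE
      exact hf.2 ⟨e', he', rfl⟩)
    simpa using Set.ncard_le_card S
  have h0 : 0 ∈ erdosRogersSet r F G n := by
    intro H _ _ _
    refine ⟨∅, by simp, ?_⟩
    rintro ⟨f, -, hf⟩
    exact (hf.1 ⟨x, hxV, rfl⟩).2
  have hbdd : BddAbove (erdosRogersSet r F G n) := ⟨n, hb⟩
  exact ⟨Nat.sSup_mem ⟨0, h0⟩ hbdd, fun m hm => le_csSup hbdd hm⟩

end Hypergraph

/-!
The upper bound comes from a random `r`-graph on `n` vertices that is `G`-free for structural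
reasons. Take `L` of order `log n` colours, a map `f i` from the vertices to `V(F)` for each colour
`i`, and a colouring `χ` of the pairs. An `r`-set is an edge if its pairs have a common colour `i` and
`f i` maps it onto an edge of `F`. Two edges that share a pair have the same colour, so a
`2`-tightly connected subgraph lives in a single colour `i`, where `f i` is a homomorphism to `F`
(`Hypergraph.isFree_ofColoring`).

It remains to choose `f` and `χ` so that every `m`-set contains a copy of `F`, where
`m > c * (log n) ^ α_F`. With `v = |V(F)|`, a random map splits an `m`-set into `v` classes of size at
least `m / (4 * v)`, except with probability `exp (-Ω(m))`; since there are of order `log n`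
independent maps, some choice of them is balanced on each of the at most `n ^ m` sets in at least one
colour (`exists_balanced_maps`). Given such an `m`-set and colour `i`, a copy of `F` appears as soon
as the pairs of colour `i`, a `1 / L`-random set, contain a copy of the shadow `∂₂ F` that is
transversal to the classes. Janson's inequality (`janson_exp_sub`, derived from the FKG inequality and
sharpened by passing to a random subfamily) bounds the probability of failure by `exp (-Ω(B))`, where
`B` is the least expected number `k ^ v(F') * L ^ (-e(F'))` of copies of a subgraph `F'` of `∂₂ F`, and
`k` is the size of the classes. The union bound over `m`-sets needs `B` of order at least `k * L`, that
is, `k ^ (v(F') - 1)` of order at least `L ^ (e(F') + 1)` for all `F'`, and this is the definition of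
`α_F`.

Probabilities are finite sums: over subsets with weights `bernoulliWeight p`, to which uniform
colourings are transferred by `card_filter_colorClass`.
-/

/-! ### Random subsets and Janson's inequality -/

section Janson

open Finset

variable {ι κ : Type*} [Fintype ι] [Fintype κ]

/-- The probability that a `p`-random subset of the finite type `ι` equals `R`. -/
def bernoulliWeight (p : ℝ) (R : Finset ι) : ℝ :=
  p ^ #R * (1 - p) ^ (Fintype.card ι - #R)

lemma bernoulliWeight_nonneg {p : ℝ} (h0 : 0 ≤ p) (h1 : p ≤ 1) (R : Finset ι) :
    0 ≤ bernoulliWeight p R :=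
  mul_nonneg (pow_nonneg h0 _) (pow_nonneg (sub_nonneg.2 h1) _)

lemma sum_bernoulliWeight (p : ℝ) : ∑ R : Finset ι, bernoulliWeight p R = 1 := by
  have h := Finset.sum_pow_mul_eq_add_pow p (1 - p) (univ : Finset ι)
  simpa [bernoulliWeight] using h

variable [DecidableEq ι] [DecidableEq κ]

lemma bernoulliWeight_mul_bernoulliWeight (p : ℝ) (R T : Finset ι) :
    bernoulliWeight p R * bernoulliWeight p T =
      bernoulliWeight p (R ∩ T) * bernoulliWeight p (R ∪ T) := by
  have h := card_inter_add_card_union R T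
  have hR := card_le_univ R
  have hT := card_le_univ T
  have hU := card_le_univ (R ∪ T)
  have hI := card_le_univ (R ∩ T)
  unfold bernoulliWeight
  rw [mul_mul_mul_comm, mul_mul_mul_comm (p ^ #(R ∩ T)), ← pow_add, ← pow_add, ← pow_add,
    ← pow_add, h]
  congr 2
  omega

lemma sum_bernoulliWeight_mem (p : ℝ) (i : ι) (g : Finset ι → ℝ) :
    ∑ R : Finset ι, bernoulliWeight p R * (if i ∈ R then g R else 0) =
      p * ∑ R : Finset ι, bernoulliWeight p R * g (insert i R) := by
  have hu : (univ : Finset (Finset ι)) = (insert i (univ.erase i)).powerset := by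
    rw [insert_erase (mem_univ i), powerset_univ]
  have hi : i ∉ (univ : Finset ι).erase i := notMem_erase i _
  rw [hu, sum_powerset_insert hi, sum_powerset_insert hi, ← sum_add_distrib, ← sum_add_distrib,
    mul_sum]
  refine sum_congr rfl fun R hR => ?_
  have hiR : i ∉ R := fun h => hi (mem_powerset.1 hR h)
  have hc : #R + 1 ≤ Fintype.card ι := by
    rw [← card_insert_of_notMem hiR]; exact card_le_univ _
  obtain ⟨d, hd⟩ := Nat.exists_eq_add_of_le hc
  have e1 : Fintype.card ι - #R = d + 1 := by omega
  have e2 : Fintype.card ι - (#R + 1) = d := by omega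
  simp only [hiR, if_false, mem_insert_self, if_true, insert_idem, bernoulliWeight,
    card_insert_of_notMem hiR, e1, e2]
  ring

/-- Conditioning a random set on containing `s` amounts to adding `s` to it. -/
lemma sum_bernoulliWeight_subset (p : ℝ) (s : Finset ι) (g : Finset ι → ℝ) :
    ∑ R : Finset ι, bernoulliWeight p R * (if s ⊆ R then g R else 0) =
      p ^ #s * ∑ R : Finset ι, bernoulliWeight p R * g (R ∪ s) := by
  induction s using Finset.induction_on generalizing g with
  | empty => simp
  | insert i s hi ih =>
    have h1 : ∀ R : Finset ι, (if insert i s ⊆ R then g R else 0) =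
        if i ∈ R then (if s ⊆ R then g R else 0) else 0 := fun R => by
      simp only [insert_subset_iff, ite_and]
    have h2 : ∀ R : Finset ι, (if s ⊆ insert i R then g (insert i R) else 0) =
        if s ⊆ R then g (insert i R) else 0 := fun R => by
      simp only [subset_insert_iff_of_notMem hi]
    simp only [h1, sum_bernoulliWeight_mem, h2, ih (fun R => g (insert i R)),
      card_insert_of_notMem hi, union_insert]
    ring

lemma sum_bernoulliWeight_subset_one (p : ℝ) (s : Finset ι) :
    ∑ R : Finset ι, bernoulliWeight p R * (if s ⊆ R then 1 else 0) = p ^ #s := by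
  have h := sum_bernoulliWeight_subset p s (fun _ => 1)
  simpa [sum_bernoulliWeight] using h

/-- Harris' inequality for the increasing event `u ⊆ R` and the decreasing event that `R` contains
none of the sets `s k`. -/
lemma sum_bernoulliWeight_subset_le {p : ℝ} (h0 : 0 ≤ p) (h1 : p ≤ 1) (u : Finset ι)
    (s : κ → Finset ι) (T : Finset κ) :
    ∑ R : Finset ι, bernoulliWeight p R *
        (if u ⊆ R ∧ ∀ k ∈ T, ¬ s k ⊆ R then 1 else 0) ≤
      p ^ #u * ∑ R : Finset ι, bernoulliWeight p R * (if ∀ k ∈ T, ¬ s k ⊆ R then 1 else 0) := by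
  have h := fkg (α := Finset ι) (μ := bernoulliWeight p)
    (f := fun R => if u ⊆ R then 1 else 0) (g := fun R => 1 - if ∀ k ∈ T, ¬ s k ⊆ R then 1 else 0)
    (fun R => bernoulliWeight_nonneg h0 h1 R)
    (fun R => by dsimp only [Pi.zero_apply]; split_ifs <;> norm_num)
    (fun R => by dsimp only [Pi.zero_apply]; split_ifs <;> norm_num)
    (fun R R' hR => by
      dsimp only
      split_ifs with a b
      · exact le_rfl
      · exact absurd (a.trans hR) b
      · exact zero_le_one
      · exact le_rfl)
    (fun R R' hR => by
      dsimp only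
      split_ifs with a b b
      · exact le_rfl
      · norm_num
      · exact absurd (fun k hk hs => b k hk (hs.trans hR)) a
      · exact le_rfl)
    (fun R R' => (bernoulliWeight_mul_bernoulliWeight p R R').le)
  have e1 : ∀ R : Finset ι, (if u ⊆ R ∧ ∀ k ∈ T, ¬ s k ⊆ R then (1 : ℝ) else 0) =
      (if u ⊆ R then 1 else 0) - (if u ⊆ R then 1 else 0) *
        (1 - if ∀ k ∈ T, ¬ s k ⊆ R then 1 else 0) := fun R => by
    by_cases a : u ⊆ R <;> by_cases b : ∀ k ∈ T, ¬ s k ⊆ R <;> simp [a, b]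
  rw [sum_bernoulliWeight, one_mul, sum_bernoulliWeight_subset_one] at h
  simp only [mul_sub, mul_one, sum_sub_distrib, sum_bernoulliWeight] at h
  simp only [e1, mul_sub, mul_one, sum_sub_distrib]
  rw [sum_bernoulliWeight_subset_one] at h ⊢
  linarith

/-- Janson's inequality in the form of Boppana and Spencer: the sets are exposed one at a time, and
Harris' inequality bounds from below the conditional probability that the new one is contained in
the random set. The correlation term runs over ordered pairs, twice what is needed. -/
lemma janson_exp_sub {p : ℝ} (h0 : 0 ≤ p) (h1 : p ≤ 1) (s : κ → Finset ι) (T : Finset κ) :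
    ∑ R : Finset ι, bernoulliWeight p R * (if ∀ k ∈ T, ¬ s k ⊆ R then 1 else 0) ≤
      Real.exp (-∑ k ∈ T, p ^ #(s k) + ∑ k ∈ T, ∑ j ∈ T,
        if k ≠ j ∧ ¬ Disjoint (s k) (s j) then p ^ #(s k ∪ s j) else 0) := by
  induction T using Finset.induction_on with
  | empty => simp [sum_bernoulliWeight]
  | insert k T hk ih =>
    set P : Finset κ → ℝ := fun T => ∑ R : Finset ι, bernoulliWeight p R *
      (if ∀ k ∈ T, ¬ s k ⊆ R then 1 else 0) with hP
    have hP0 : ∀ T, 0 ≤ P T := fun T => sum_nonneg fun R _ =>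
      mul_nonneg (bernoulliWeight_nonneg h0 h1 R) (by split_ifs <;> norm_num)
    set N := T.filter fun j => ¬ Disjoint (s k) (s j) with hN
    set I := T.filter fun j => Disjoint (s k) (s j) with hI
    set x := p ^ #(s k) - ∑ j ∈ N, p ^ #(s k ∪ s j) with hx
    -- `N` and `I` are the earlier sets that meet, respectively miss, the new set `s k`.
    have hmono : P T ≤ P I := sum_le_sum fun R _ =>
      mul_le_mul_of_nonneg_left (by
        split_ifs with a b
        · exact le_rfl
        · exact absurd (fun j hj => a j (mem_filter.1 hj).1) b
        · exact zero_le_one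
        · exact le_rfl) (bernoulliWeight_nonneg h0 h1 R)
    have hind : ∑ R : Finset ι, bernoulliWeight p R *
        (if s k ⊆ R ∧ ∀ j ∈ I, ¬ s j ⊆ R then 1 else 0) = p ^ #(s k) * P I := by
      have h := sum_bernoulliWeight_subset p (s k)
        (fun R => if ∀ j ∈ I, ¬ s j ⊆ R then 1 else 0)
      have e : ∀ R, (∀ j ∈ I, ¬ s j ⊆ R ∪ s k) ↔ ∀ j ∈ I, ¬ s j ⊆ R := fun R =>
        forall₂_congr fun j hj => not_congr
          ⟨fun h => (Disjoint.left_le_of_le_sup_right h (mem_filter.1 hj).2.symm),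
            fun h => h.trans subset_union_left⟩
      simpa only [e, ite_and] using h
    have hstep : P (insert k T) ≤ P T - ∑ R : Finset ι, bernoulliWeight p R *
        ((if s k ⊆ R ∧ ∀ j ∈ I, ¬ s j ⊆ R then 1 else 0) -
          ∑ j ∈ N, if s k ∪ s j ⊆ R ∧ ∀ j ∈ I, ¬ s j ⊆ R then 1 else 0) := by
      rw [hP, ← sum_sub_distrib]
      refine sum_le_sum fun R _ => ?_
      rw [← mul_sub]
      refine mul_le_mul_of_nonneg_left ?_ (bernoulliWeight_nonneg h0 h1 R)
      have hs0 : ∀ j ∈ N,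
          (0 : ℝ) ≤ if s k ∪ s j ⊆ R ∧ ∀ j ∈ I, ¬ s j ⊆ R then 1 else 0 := fun j _ => by
        split_ifs <;> norm_num
      have hs := sum_nonneg hs0
      by_cases a : s k ⊆ R
      · by_cases b : ∀ j ∈ I, ¬ s j ⊆ R
        · by_cases c : ∀ j ∈ T, ¬ s j ⊆ R
          · have e : ∑ j ∈ N, (if s k ∪ s j ⊆ R ∧ ∀ j ∈ I, ¬ s j ⊆ R then (1 : ℝ) else 0) = 0 :=
              sum_eq_zero fun j hj => if_neg fun h =>
                c j (mem_filter.1 hj).1 (subset_union_right.trans h.1)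
            rw [e, if_neg (fun h => h k (mem_insert_self _ _) a), if_pos c, if_pos ⟨a, b⟩]
            norm_num
          · rw [if_neg (fun h => c fun j hj => h j (mem_insert_of_mem hj)), if_neg c,
              if_pos ⟨a, b⟩]
            push Not at c
            obtain ⟨j, hj, hjR⟩ := c
            have hjN : j ∈ N := by
              refine mem_filter.2 ⟨hj, fun hd => b j (mem_filter.2 ⟨hj, hd⟩) hjR⟩
            have := single_le_sum hs0 hjN
            rw [if_pos ⟨union_subset a hjR, b⟩] at this
            linarith
        · have c : ¬ ∀ j ∈ T, ¬ s j ⊆ R := fun h => b fun j hj => h j (mem_filter.1 hj).1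
          rw [if_neg (fun h => c fun j hj => h j (mem_insert_of_mem hj)), if_neg c,
            if_neg (fun h => b h.2)]
          linarith
      · rw [if_neg (fun h : s k ⊆ R ∧ _ => a h.1)]
        simp only [forall_mem_insert, a, not_false_eq_true, true_and]
        linarith
    have hle : P I * x ≤ ∑ R : Finset ι, bernoulliWeight p R *
        ((if s k ⊆ R ∧ ∀ j ∈ I, ¬ s j ⊆ R then 1 else 0) -
          ∑ j ∈ N, if s k ∪ s j ⊆ R ∧ ∀ j ∈ I, ¬ s j ⊆ R then 1 else 0) := by
      simp only [mul_sub, sum_sub_distrib, mul_sum, hind]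
      rw [sum_comm, hx, mul_sub, mul_sum, mul_comm]
      refine sub_le_sub_left (sum_le_sum fun j _ => ?_) _
      rw [mul_comm]
      exact sum_bernoulliWeight_subset_le h0 h1 _ s I
    have hmain : P (insert k T) ≤ P T * Real.exp (-x) := by
      have hexp := Real.add_one_le_exp (-x)
      rcases le_total 0 x with hx0 | hx0
      · nlinarith [mul_le_mul_of_nonneg_right hmono hx0,
          mul_le_mul_of_nonneg_left hexp (hP0 T)]
      · have hm : P (insert k T) ≤ P T := sum_le_sum fun R _ =>
          mul_le_mul_of_nonneg_left (by
            split_ifs with a b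
            · exact le_rfl
            · exact absurd (fun j hj => a j (mem_insert_of_mem hj)) b
            · exact zero_le_one
            · exact le_rfl) (bernoulliWeight_nonneg h0 h1 R)
        nlinarith [mul_le_mul_of_nonneg_left hexp (hP0 T), mul_nonneg (hP0 T) (neg_nonneg.2 hx0)]
    refine hmain.trans ((mul_le_mul_of_nonneg_right ih (Real.exp_nonneg _)).trans ?_)
    rw [← Real.exp_add, Real.exp_le_exp, sum_insert hk, sum_insert hk, sum_insert hk]
    have hkT : ∑ j ∈ T, (if k ≠ j ∧ ¬ Disjoint (s k) (s j) then p ^ #(s k ∪ s j) else 0) =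
        ∑ j ∈ N, p ^ #(s k ∪ s j) := by
      rw [hN, sum_filter]
      refine sum_congr rfl fun j hj => ?_
      have : k ≠ j := fun h => hk (h ▸ hj)
      simp [this]
    have hT : ∑ i ∈ T, ∑ j ∈ T,
        (if i ≠ j ∧ ¬ Disjoint (s i) (s j) then p ^ #(s i ∪ s j) else 0) ≤
        ∑ i ∈ T, ∑ j ∈ insert k T,
          if i ≠ j ∧ ¬ Disjoint (s i) (s j) then p ^ #(s i ∪ s j) else 0 :=
      sum_le_sum fun i _ => sum_le_sum_of_subset_of_nonneg (subset_insert _ _) fun j _ _ => by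
        split_ifs
        · exact pow_nonneg h0 _
        · exact le_rfl
    rw [hkT, if_neg (fun h => h.1 rfl)]
    linarith

/-- Averaging over a `q`-random subfamily: a linear term scales by `q`, and a sum over pairs of
distinct members by `q ^ 2`. -/
lemma exists_subfamily_le {q : ℝ} (h0 : 0 ≤ q) (h1 : q ≤ 1) (a : κ → ℝ) (b : κ → κ → ℝ)
    (hb : ∀ k, b k k = 0) :
    ∃ T : Finset κ, -∑ k ∈ T, a k + ∑ k ∈ T, ∑ j ∈ T, b k j ≤
      -(q * ∑ k, a k) + q ^ 2 * ∑ k, ∑ j, b k j := by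
  by_contra! hcon
  set y := -(q * ∑ k, a k) + q ^ 2 * ∑ k, ∑ j, b k j with hy
  have hlin : ∑ T : Finset κ, bernoulliWeight q T * ∑ k ∈ T, a k = q * ∑ k, a k := by
    have e : ∀ T : Finset κ, ∑ k ∈ T, a k = ∑ k, a k * if {k} ⊆ T then 1 else 0 := fun T => by
      simp
    simp only [e, mul_sum]
    rw [sum_comm]
    refine sum_congr rfl fun k _ => ?_
    have h := sum_bernoulliWeight_subset_one q ({k} : Finset κ)
    rw [card_singleton, pow_one] at h
    calc _ = a k * ∑ T : Finset κ, bernoulliWeight q T * (if {k} ⊆ T then 1 else 0) := by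
          rw [mul_sum]; exact sum_congr rfl fun T _ => by ring
      _ = _ := by rw [h, if_pos (subset_univ _), mul_one, mul_comm]
  have hquad : ∑ T : Finset κ, bernoulliWeight q T * ∑ k ∈ T, ∑ j ∈ T, b k j =
      q ^ 2 * ∑ k, ∑ j, b k j := by
    have e : ∀ T : Finset κ, ∑ k ∈ T, ∑ j ∈ T, b k j =
        ∑ k, ∑ j, b k j * if {k, j} ⊆ T then 1 else 0 := fun T => by
      rw [← sum_subset (subset_univ T) (fun k _ hk => sum_eq_zero fun j _ => by
        rw [if_neg (fun h => hk (h (mem_insert_self _ _))), mul_zero])]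
      refine sum_congr rfl fun k hk => ?_
      rw [← sum_subset (subset_univ T) (fun j _ hj => by
        rw [if_neg (fun h => hj (h (mem_insert_of_mem (mem_singleton_self _)))), mul_zero])]
      refine sum_congr rfl fun j hj => ?_
      rw [if_pos (insert_subset hk (singleton_subset_iff.2 hj)), mul_one]
    simp only [e, mul_sum]
    rw [sum_comm]
    refine sum_congr rfl fun k _ => ?_
    rw [sum_comm]
    refine sum_congr rfl fun j _ => ?_
    have h := sum_bernoulliWeight_subset_one q ({k, j} : Finset κ)
    calc _ = b k j * ∑ T : Finset κ, bernoulliWeight q T * (if {k, j} ⊆ T then 1 else 0) := by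
          rw [mul_sum]; exact sum_congr rfl fun T _ => by ring
      _ = _ := by
        rw [h]
        rcases eq_or_ne k j with rfl | hkj
        · rw [hb]; ring
        · rw [card_pair hkj, if_pos (subset_univ _), mul_one, mul_comm]
  have hsum : ∑ T : Finset κ, bernoulliWeight q T *
      ((-∑ k ∈ T, a k + ∑ k ∈ T, ∑ j ∈ T, b k j) - y) = 0 := by
    simp only [mul_sub, mul_add, mul_neg, sum_sub_distrib, sum_add_distrib, sum_neg_distrib,
      hlin, hquad, ← sum_mul, sum_bernoulliWeight]
    ring
  -- A weighted average of positive numbers vanishes only if all the weights do.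
  have hzero := (sum_eq_zero_iff_of_nonneg fun T _ =>
    mul_nonneg (bernoulliWeight_nonneg h0 h1 T) (sub_nonneg.2 (hcon T).le)).1 hsum
  have hw : ∀ T : Finset κ, bernoulliWeight q T = 0 := fun T =>
    (mul_eq_zero.1 (hzero T (mem_univ T))).resolve_right (sub_ne_zero.2 (hcon T).ne')
  have h := sum_bernoulliWeight (ι := κ) q
  simp [hw] at h

/-- Janson's inequality applied to a subfamily of density `q`, chosen so that the correlation term
becomes harmless. -/
lemma janson_exp_sub_density {p q : ℝ} (h0 : 0 ≤ p) (h1 : p ≤ 1) (hq0 : 0 ≤ q) (hq1 : q ≤ 1)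
    (s : κ → Finset ι) :
    ∑ R : Finset ι, bernoulliWeight p R * (if ∀ k, ¬ s k ⊆ R then 1 else 0) ≤
      Real.exp (-(q * ∑ k, p ^ #(s k)) + q ^ 2 * ∑ k, ∑ j,
        if k ≠ j ∧ ¬ Disjoint (s k) (s j) then p ^ #(s k ∪ s j) else 0) := by
  obtain ⟨T, hT⟩ := exists_subfamily_le hq0 hq1 (fun k => p ^ #(s k))
    (fun k j => if k ≠ j ∧ ¬ Disjoint (s k) (s j) then p ^ #(s k ∪ s j) else 0) (by simp)
  refine le_trans (sum_le_sum fun R _ => mul_le_mul_of_nonneg_left ?_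
    (bernoulliWeight_nonneg h0 h1 R)) ((janson_exp_sub h0 h1 s T).trans (Real.exp_le_exp.2 hT))
  split_ifs with a b
  · exact le_rfl
  · exact absurd (fun j _ => a j) b
  · exact zero_le_one
  · exact le_rfl

end Janson

/-! ### Transversal copies in a random set family -/

section Transversal

open Finset

variable {U V : Type*} [DecidableEq U] [DecidableEq V]

lemma image_image_of_leftInverse {f : U → V} {g : V → U} (h : ∀ x, f (g x) = x)
    (z : Finset V) : (z.image g).image f = z := by
  rw [image_image, show f ∘ g = id from funext h, image_id]

lemma card_image_image_of_leftInverse {f : U → V} {g : V → U} (h : ∀ x, f (g x) = x)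
    (D : Finset (Finset V)) : #(D.image (image g)) = #D :=
  card_image_of_injective _ fun z z' hz => by
    rw [← image_image_of_leftInverse h z, hz, image_image_of_leftInverse h]

variable [Fintype V]

/-- Two transversal copies of `D` share exactly the members of `D` on which they agree. -/
lemma image_inter_image_of_leftInverse {f : U → V} {g h : V → U} (hg : ∀ x, f (g x) = x)
    (hh : ∀ x, f (h x) = x) (D : Finset (Finset V)) :
    D.image (image g) ∩ D.image (image h) =
      (D.filter fun z => z ⊆ univ.filter fun x => h x = g x).image (image g) := by
  ext y
  simp only [mem_inter, mem_image, mem_filter]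
  constructor
  · rintro ⟨⟨z, hz, rfl⟩, z', hz', e⟩
    have hzz : z' = z := by
      rw [← image_image_of_leftInverse hh z', e, image_image_of_leftInverse hg]
    subst hzz
    refine ⟨z', ⟨hz, fun x hx => mem_filter.2 ⟨mem_univ _, ?_⟩⟩, rfl⟩
    have hm : h x ∈ z'.image g := e ▸ mem_image_of_mem h hx
    obtain ⟨x', -, hx'⟩ := mem_image.1 hm
    have : x' = x := by rw [← hg x', hx', hh]
    rw [← hx', this]
  · rintro ⟨z, ⟨hz, hJ⟩, rfl⟩
    exact ⟨⟨z, hz, rfl⟩, z, hz, image_congr fun x hx => (mem_filter.1 (hJ hx)).2⟩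

lemma sum_pow_card_agree_le (T : V → Finset U) {k : ℕ} (hT : ∀ x, #(T x) = k) (g : V → U) :
    ∑ h ∈ Fintype.piFinset T, (k : ℝ) ^ #(univ.filter fun x => h x = g x) ≤
      (2 * k) ^ Fintype.card V := by
  have e : ∀ h : V → U, (k : ℝ) ^ #(univ.filter fun x => h x = g x) =
      ∏ x, if h x = g x then (k : ℝ) else 1 := fun h => by
    rw [prod_ite, prod_const, prod_const_one, mul_one]
  simp only [e]
  rw [← prod_univ_sum T fun x a => if a = g x then (k : ℝ) else 1]
  refine (prod_le_prod (fun x _ => sum_nonneg fun a _ => by split_ifs <;> positivity)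
    (g := fun _ => 2 * (k : ℝ)) fun x _ => ?_).trans (by simp)
  calc ∑ a ∈ T x, (if a = g x then (k : ℝ) else 1)
      ≤ ∑ a ∈ T x, ((if a = g x then (k : ℝ) else 0) + 1) :=
        sum_le_sum fun a _ => by split_ifs <;> simp
    _ ≤ 2 * k := by
        rw [sum_add_distrib, sum_ite_eq', sum_const, hT, nsmul_eq_mul, mul_one]
        split_ifs <;> linarith [Nat.cast_nonneg (α := ℝ) k]

variable [Fintype U]

/-- A `p`-random family of subsets of `U` fails to contain a transversal copy of `D` with
probability exponentially small in `B`, a lower bound for the expected number of copies in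
`∐ T x` of each nonempty subfamily of `D` induced on a set of vertices. -/
lemma sum_bernoulliWeight_no_transversal_le {f : U → V} {T : V → Finset U} {k : ℕ}
    (hT : ∀ x, #(T x) = k) (hf : ∀ x, ∀ u ∈ T x, f u = x) {D : Finset (Finset V)}
    (hD : D.Nonempty) {p B : ℝ} (hp0 : 0 < p) (hp1 : p ≤ 1) (hB0 : 0 < B)
    (hB : ∀ J : Finset V, (D.filter (· ⊆ J)).Nonempty →
      B ≤ (k : ℝ) ^ #J * p ^ #(D.filter (· ⊆ J))) :
    ∑ R : Finset (Finset U), bernoulliWeight p R *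
        (if ∀ g ∈ Fintype.piFinset T, ¬ D.image (image g) ⊆ R then 1 else 0) ≤
      Real.exp (-(B / 2 ^ (Fintype.card V + 2))) := by
  set v := Fintype.card V with hv
  set M : ℝ := (k : ℝ) ^ v * p ^ #D with hM
  have hBM : B ≤ M := by
    have h := hB univ (by simpa using hD)
    simpa [hM, hv, card_univ] using h
  have hM0 : 0 < M := hB0.trans_le hBM
  -- The value of `q` minimising the exponent `-q * M + q ^ 2 * (2 ^ v * M ^ 2 / B)`.
  set q : ℝ := B / (2 ^ (v + 1) * M) with hq
  have hq0 : 0 ≤ q := by positivity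
  have hq1 : q ≤ 1 := by
    rw [hq, div_le_one (by positivity)]
    exact hBM.trans (le_mul_of_one_le_left hM0.le (one_le_pow₀ one_le_two))
  have hleft : ∀ g ∈ Fintype.piFinset T, ∀ x, f (g x) = x := fun g hg x =>
    hf x _ (Fintype.mem_piFinset.1 hg x)
  have hJ := janson_exp_sub_density hp0.le hp1 hq0 hq1
    (fun g : ↥(Fintype.piFinset T) => D.image (image g.1))
  have hcard : #(Fintype.piFinset T) = k ^ v := by
    rw [Fintype.card_piFinset, prod_congr rfl fun x _ => hT x, prod_const, card_univ]
  have hmu : ∑ g : ↥(Fintype.piFinset T), p ^ #(D.image (image g.1)) = M := by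
    rw [sum_congr rfl fun g _ => by
      rw [card_image_image_of_leftInverse (hleft g.1 g.2)], sum_const, card_univ,
      Fintype.card_coe, hcard, nsmul_eq_mul, hM]
    push_cast; rfl
  have hpair : ∀ g ∈ Fintype.piFinset T, ∀ h ∈ Fintype.piFinset T,
      B * (if ¬ Disjoint (D.image (image g)) (D.image (image h)) then
        p ^ #(D.image (image g) ∪ D.image (image h)) else 0) ≤
      p ^ (2 * #D) * (k : ℝ) ^ #(univ.filter fun x => h x = g x) := by
    intro g hg h hh
    split_ifs with hd
    · rw [mul_zero]; positivity
    · set J := univ.filter fun x => h x = g x with hJdef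
      have hint := image_inter_image_of_leftInverse (hleft g hg) (hleft h hh) D
      rw [← hJdef] at hint
      have hne : (D.filter (· ⊆ J)).Nonempty := by
        rw [disjoint_iff_inter_eq_empty, ← ne_eq, ← nonempty_iff_ne_empty, hint] at hd
        exact image_nonempty.1 hd
      have hc := card_inter_add_card_union (D.image (image g)) (D.image (image h))
      rw [hint, card_image_image_of_leftInverse (hleft g hg),
        card_image_image_of_leftInverse (hleft g hg),
        card_image_image_of_leftInverse (hleft h hh)] at hc
      have h2 : 2 * #D = #(D.filter (· ⊆ J)) + #(D.image (image g) ∪ D.image (image h)) := by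
        omega
      rw [h2, pow_add]
      nlinarith [mul_le_mul_of_nonneg_right (hB J hne)
        (pow_nonneg hp0.le #(D.image (image g) ∪ D.image (image h)))]
  have hdelta : B * ∑ g : ↥(Fintype.piFinset T), ∑ h : ↥(Fintype.piFinset T),
      (if g ≠ h ∧ ¬ Disjoint (D.image (image g.1)) (D.image (image h.1)) then
        p ^ #(D.image (image g.1) ∪ D.image (image h.1)) else 0) ≤ 2 ^ v * M ^ 2 := by
    calc _ ≤ ∑ g : ↥(Fintype.piFinset T), ∑ h : ↥(Fintype.piFinset T),
          p ^ (2 * #D) * (k : ℝ) ^ #(univ.filter fun x => h.1 x = g.1 x) := by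
          simp only [mul_sum]
          refine sum_le_sum fun g _ => sum_le_sum fun h _ =>
            le_trans (mul_le_mul_of_nonneg_left ?_ hB0.le) (hpair g.1 g.2 h.1 h.2)
          rw [ite_and]
          split_ifs
          all_goals first | exact le_rfl | exact pow_nonneg hp0.le _
      _ ≤ ∑ g : ↥(Fintype.piFinset T), p ^ (2 * #D) * (2 * k) ^ v := by
          refine sum_le_sum fun g _ => ?_
          rw [← mul_sum, sum_coe_sort (Fintype.piFinset T)
            (fun h => (k : ℝ) ^ #(univ.filter fun x => h x = g.1 x))]
          exact mul_le_mul_of_nonneg_left (sum_pow_card_agree_le T hT g.1) (by positivity)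
      _ = 2 ^ v * M ^ 2 := by
          rw [sum_const, card_univ, Fintype.card_coe, hcard, nsmul_eq_mul, hM]
          push_cast; ring
  rw [hmu] at hJ
  have e : ∀ R : Finset (Finset U), (∀ g ∈ Fintype.piFinset T, ¬ D.image (image g) ⊆ R) ↔
      ∀ g : ↥(Fintype.piFinset T), ¬ D.image (image g.1) ⊆ R := fun R =>
    ⟨fun h g => h g.1 g.2, fun h g hg => h ⟨g, hg⟩⟩
  simp only [e]
  refine hJ.trans (Real.exp_le_exp.2 ?_)
  set S := ∑ g : ↥(Fintype.piFinset T), ∑ h : ↥(Fintype.piFinset T),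
      (if g ≠ h ∧ ¬ Disjoint (D.image (image g.1)) (D.image (image h.1)) then
        p ^ #(D.image (image g.1) ∪ D.image (image h.1)) else 0) with hS
  have hSle : S ≤ 2 ^ v * M ^ 2 / B := by rw [le_div_iff₀ hB0, mul_comm]; exact hdelta
  calc -(q * M) + q ^ 2 * S ≤ -(q * M) + q ^ 2 * (2 ^ v * M ^ 2 / B) := by gcongr
    _ = -(B / 2 ^ (v + 2)) := by
      rw [hq]; field_simp; ring

end Transversal

/-! ### Counting colourings and vertex maps -/

section Counting

open Finset

/-- A colour class of a uniformly random colouring with `L` colours is a `1 / L`-random set. -/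
lemma card_filter_colorClass {ι : Type*} [Fintype ι] [DecidableEq ι] {L : ℕ} (hL : 0 < L)
    (i : Fin L) (P : Finset ι → Prop) [DecidablePred P] :
    (#(univ.filter fun χ : ι → Fin L => P (univ.filter fun e => χ e = i)) : ℝ) =
      (L : ℝ) ^ Fintype.card ι *
        ∑ R : Finset ι, bernoulliWeight (1 / L : ℝ) R * (if P R then 1 else 0) := by
  have hL' : (L : ℝ) ≠ 0 := by positivity
  have hfib : ∀ R : Finset ι, #(univ.filter fun χ : ι → Fin L =>
      (univ.filter fun e => χ e = i) = R) = (L - 1) ^ (Fintype.card ι - #R) := fun R => by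
    have e : (univ.filter fun χ : ι → Fin L => (univ.filter fun e => χ e = i) = R) =
        Fintype.piFinset fun e => if e ∈ R then {i} else univ.erase i := by
      ext χ
      simp only [mem_filter, mem_univ, true_and, Fintype.mem_piFinset, Finset.ext_iff]
      refine forall_congr' fun e => ?_
      by_cases he : e ∈ R <;> simp [he]
    rw [e, Fintype.card_piFinset]
    simp only [apply_ite card, card_singleton, card_erase_of_mem (mem_univ i), card_univ,
      Fintype.card_fin]
    rw [prod_ite, prod_const_one, one_mul, prod_const]
    congr 1
    rw [filter_not, filter_mem_eq_inter, univ_inter, card_sdiff_of_subset (subset_univ R),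
      card_univ]
  rw [card_eq_sum_card_fiberwise (f := fun χ : ι → Fin L => univ.filter fun e => χ e = i)
    (t := univ) (fun _ _ => mem_coe.2 (mem_univ _)), Nat.cast_sum, mul_sum]
  refine sum_congr rfl fun R _ => ?_
  rw [filter_filter]
  split_ifs with hP
  · have e : (univ.filter fun χ : ι → Fin L => P (univ.filter fun e => χ e = i) ∧
        (univ.filter fun e => χ e = i) = R) =
        univ.filter fun χ : ι → Fin L => (univ.filter fun e => χ e = i) = R :=
      filter_congr fun χ _ => ⟨fun h => h.2, fun h => ⟨h ▸ hP, h⟩⟩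
    obtain ⟨d, hd⟩ := Nat.exists_eq_add_of_le (card_le_univ R)
    have e1 : (1 : ℝ) - 1 / L = (L - 1) / L := by field_simp
    rw [e, hfib, bernoulliWeight, hd, Nat.add_sub_cancel_left, e1, div_pow, div_pow, one_pow,
      pow_add]
    push_cast [Nat.cast_sub (show 1 ≤ L from hL)]
    field_simp
  · have e : (univ.filter fun χ : ι → Fin L => P (univ.filter fun e => χ e = i) ∧
        (univ.filter fun e => χ e = i) = R) = ∅ :=
      filter_eq_empty_iff.2 fun χ _ h => hP (h.2 ▸ h.1)
    rw [e]; simp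

variable {U V : Type*} [Fintype U] [DecidableEq U] [Fintype V] [DecidableEq V]

/-- An exponential-moment bound for the number of maps `U → V` that hit `x` on fewer than
`m / (4 * v)` points of an `m`-set, where `v = card V`. -/
lemma card_filter_small_class_le [Nonempty V] (S : Finset U) (x : V) :
    (#(univ.filter fun h : U → V =>
        4 * Fintype.card V * #(S.filter fun u => h u = x) < #S) : ℝ) ≤
      (Fintype.card V : ℝ) ^ Fintype.card U * Real.exp (-(#S / (4 * Fintype.card V))) := by
  set v := Fintype.card V with hv
  have hv0 : (0 : ℝ) < v := by exact_mod_cast Fintype.card_pos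
  -- The class of `x` is binomial; the base `1 / 2` of the moment is `≥ exp (-1)` and costs each point
  -- of `S` a factor `1 - 1 / (2 * v)`.
  have hmom : ∑ h : U → V, (1 / 2 : ℝ) ^ #(S.filter fun u => h u = x) ≤
      (v : ℝ) ^ Fintype.card U * Real.exp (-(#S / (2 * v))) := by
    have e : ∀ h : U → V, (1 / 2 : ℝ) ^ #(S.filter fun u => h u = x) =
        ∏ u, if u ∈ S ∧ h u = x then (1 / 2 : ℝ) else 1 := fun h => by
      rw [prod_ite, prod_const, prod_const_one, mul_one]
      congr 2; ext; simp
    simp only [e]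
    have hprod := prod_univ_sum (fun _ : U => (univ : Finset V))
      (fun u a => if u ∈ S ∧ a = x then (1 / 2 : ℝ) else 1)
    rw [Fintype.piFinset_univ] at hprod
    rw [← hprod]
    have hfac : ∀ u : U, ∑ a : V, (if u ∈ S ∧ a = x then (1 / 2 : ℝ) else 1) =
        if u ∈ S then (v : ℝ) - 1 / 2 else v := fun u => by
      have e' : ∀ a : V, (if u ∈ S ∧ a = x then (1 / 2 : ℝ) else 1) =
          1 - if a = x then (if u ∈ S then 1 / 2 else 0) else 0 := fun a => by
        by_cases h1 : u ∈ S <;> by_cases h2 : a = x <;> simp [h1, h2]; norm_num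
      simp only [e', sum_sub_distrib, sum_ite_eq', mem_univ, if_true, sum_const, card_univ,
        nsmul_eq_mul, mul_one]
      split_ifs <;> simp [hv]
    have hle : ∀ u : U, (if u ∈ S then (v : ℝ) - 1 / 2 else v) ≤
        v * if u ∈ S then Real.exp (-(1 / (2 * v))) else 1 := fun u => by
      split_ifs
      · have h := mul_le_mul_of_nonneg_left (Real.add_one_le_exp (-(1 / (2 * (v : ℝ))))) hv0.le
        refine le_trans (le_of_eq ?_) h
        field_simp; ring
      · simp
    have hv1 : (1 : ℝ) ≤ v := by exact_mod_cast (Fintype.card_pos : 0 < Fintype.card V)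
    simp only [hfac]
    refine (prod_le_prod (fun u _ => by split_ifs <;> linarith) fun u _ => hle u).trans
      (le_of_eq ?_)
    rw [prod_mul_distrib, prod_const, card_univ, prod_ite_mem, univ_inter, prod_const,
      ← Real.exp_nat_mul]
    congr 2
    field_simp
  have hlow : (#(univ.filter fun h : U → V => 4 * v * #(S.filter fun u => h u = x) < #S) : ℝ) *
      Real.exp (-(#S / (4 * v))) ≤ ∑ h : U → V, (1 / 2 : ℝ) ^ #(S.filter fun u => h u = x) := by
    rw [← nsmul_eq_mul, ← sum_const]
    refine (sum_le_sum fun h hh => ?_).trans (sum_le_sum_of_subset_of_nonneg (filter_subset _ _)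
      fun h _ _ => by positivity)
    have hlt : (4 * v * #(S.filter fun u => h u = x) : ℝ) < #S := by
      exact_mod_cast (mem_filter.1 hh).2
    have hhalf : Real.exp (-1) ≤ 1 / 2 := by
      rw [Real.exp_neg, one_div]
      exact inv_anti₀ two_pos (by linarith [Real.add_one_le_exp 1])
    calc Real.exp (-(#S / (4 * v))) ≤ Real.exp (#(S.filter fun u => h u = x) * (-1)) := by
          rw [Real.exp_le_exp, mul_neg_one, neg_le_neg_iff, le_div_iff₀ (by positivity)]
          linarith
      _ = Real.exp (-1) ^ #(S.filter fun u => h u = x) := Real.exp_nat_mul _ _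
      _ ≤ _ := by gcongr
  have hexp : Real.exp (-(#S / (2 * v) : ℝ)) =
      Real.exp (-(#S / (4 * v))) * Real.exp (-(#S / (4 * v))) := by
    rw [← Real.exp_add]; congr 1; field_simp; ring
  have hpos := Real.exp_pos (-(#S / (4 * v) : ℝ))
  have := hlow.trans hmom
  rw [hexp, ← mul_assoc] at this
  exact le_of_mul_le_mul_right this hpos

/-- Some family of `L` maps `U → V` is, on every `m`-set, balanced in at least one member, once the
union bound over the `m`-sets allows it. -/
lemma exists_balanced_maps [Nonempty V] {m L : ℕ}
    (h : (Fintype.card U : ℝ) ^ m *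
      (Fintype.card V * Real.exp (-(m / (4 * Fintype.card V)))) ^ L < 1) :
    ∃ f : Fin L → U → V, ∀ S : Finset U, #S = m → ∃ i, ∀ x,
      m ≤ 4 * Fintype.card V * #(S.filter fun u => f i u = x) := by
  set v := Fintype.card V with hv
  by_contra! hcon
  have hv0 : (0 : ℝ) < v := by exact_mod_cast Fintype.card_pos
  set bad : Finset U → Finset (U → V) := fun S => univ.biUnion fun x =>
    univ.filter fun h : U → V => 4 * v * #(S.filter fun u => h u = x) < #S with hbad
  have hcover : (univ : Finset (Fin L → U → V)) ⊆
      (powersetCard m univ).biUnion fun S => Fintype.piFinset fun _ => bad S := by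
    intro f _
    obtain ⟨S, hS, hf⟩ := hcon f
    refine mem_biUnion.2 ⟨S, mem_powersetCard.2 ⟨subset_univ _, hS⟩,
      Fintype.mem_piFinset.2 fun i => ?_⟩
    obtain ⟨x, hx⟩ := hf i
    exact mem_biUnion.2 ⟨x, mem_univ _, mem_filter.2 ⟨mem_univ _, hS ▸ hx⟩⟩
  have hbadcard : ∀ S ∈ powersetCard m (univ : Finset U), (#(bad S) : ℝ) ≤
      (v : ℝ) ^ Fintype.card U * (v * Real.exp (-(m / (4 * v)))) := fun S hS => by
    have hSm := (mem_powersetCard.1 hS).2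
    have h1 : (#(bad S) : ℝ) ≤ ∑ x : V, (#(univ.filter fun h : U → V =>
        4 * v * #(S.filter fun u => h u = x) < #S) : ℝ) := by exact_mod_cast card_biUnion_le
    refine h1.trans ((sum_le_sum fun x _ => card_filter_small_class_le S x).trans (le_of_eq ?_))
    rw [sum_const, card_univ, nsmul_eq_mul, hSm]
    ring
  have hle : (v : ℝ) ^ (Fintype.card U * L) ≤ (Fintype.card U : ℝ) ^ m *
      ((v : ℝ) ^ Fintype.card U * (v * Real.exp (-(m / (4 * v))))) ^ L := by
    have h1 := (card_le_card hcover).trans card_biUnion_le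
    rw [card_univ, Fintype.card_fun, Fintype.card_fun, Fintype.card_fin, ← pow_mul] at h1
    have h2 : (v : ℝ) ^ (Fintype.card U * L) ≤ ∑ S ∈ powersetCard m (univ : Finset U),
        (#(bad S) : ℝ) ^ L := by
      simp only [Fintype.card_piFinset, prod_const, card_univ, Fintype.card_fin] at h1
      exact_mod_cast h1
    refine h2.trans ((sum_le_sum fun S hS =>
      pow_le_pow_left₀ (Nat.cast_nonneg _) (hbadcard S hS) L).trans ?_)
    rw [sum_const, card_powersetCard, card_univ, nsmul_eq_mul]
    have h3 : ((Fintype.card U).choose m : ℝ) ≤ (Fintype.card U : ℝ) ^ m := by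
      exact_mod_cast Nat.choose_le_pow _ _
    gcongr
  rw [mul_pow, ← pow_mul, mul_left_comm] at hle
  have hpos : (0 : ℝ) < (v : ℝ) ^ (Fintype.card U * L) := by positivity
  nlinarith

/-- Union bound: if every member of `𝒮` prescribes a colour `i` and a property that fails for the
`i`-coloured set with probability at most `ε`, and `#𝒮 * ε < 1`, then one colouring satisfies all
these properties. -/
lemma exists_coloring_of_unionBound {ι σ : Type*} [Fintype ι] [DecidableEq ι] {L : ℕ}
    (hL : 0 < L) (𝒮 : Finset σ) (i : σ → Fin L) (P : σ → Finset ι → Prop)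
    [∀ S, DecidablePred (P S)] {ε : ℝ} (hε : #𝒮 * ε < 1)
    (hP : ∀ S ∈ 𝒮, ∑ R : Finset ι, bernoulliWeight (1 / L : ℝ) R *
      (if P S R then 1 else 0) ≤ ε) :
    ∃ χ : ι → Fin L, ∀ S ∈ 𝒮, ¬ P S (univ.filter fun e => χ e = i S) := by
  by_contra! hcon
  have hcover : (univ : Finset (ι → Fin L)) ⊆ 𝒮.biUnion fun S =>
      univ.filter fun χ : ι → Fin L => P S (univ.filter fun e => χ e = i S) := by
    intro χ _
    obtain ⟨S, hS, h⟩ := hcon χ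
    exact mem_biUnion.2 ⟨S, hS, mem_filter.2 ⟨mem_univ _, h⟩⟩
  have h1 := (card_le_card hcover).trans card_biUnion_le
  rw [card_univ, Fintype.card_fun, Fintype.card_fin] at h1
  have h2 : (L : ℝ) ^ Fintype.card ι ≤ ∑ S ∈ 𝒮,
      (#(univ.filter fun χ : ι → Fin L => P S (univ.filter fun e => χ e = i S)) : ℝ) := by
    exact_mod_cast h1
  simp only [card_filter_colorClass hL] at h2
  have hpos : (0 : ℝ) < (L : ℝ) ^ Fintype.card ι := by positivity
  have h3 : (L : ℝ) ^ Fintype.card ι ≤ ∑ S ∈ 𝒮, (L : ℝ) ^ Fintype.card ι * ε :=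
    h2.trans (sum_le_sum fun S hS => mul_le_mul_of_nonneg_left (hP S hS) hpos.le)
  rw [sum_const, nsmul_eq_mul] at h3
  nlinarith

end Counting

/-! ### The random choice of maps and colours -/

section ProbabilisticChoice

open Finset

variable {V : Type*} [Fintype V] [DecidableEq V]

/-- There are `L ≈ 16 * v * log n` vertex maps `f i` and an `L`-colouring `χ` such that every `m`-set
contains, in some colour `i`, a transversal copy of `D` that `f i` projects back to `V`. The maps
come first: `L` of them suffice for each `m`-set to be balanced in some `i`, which then determines
where the copy in `χ` is sought. -/
lemma exists_maps_coloring [Nonempty V] {D : Finset (Finset V)} (hD : D.Nonempty) {a : ℝ}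
    (ha : ∀ J : Finset V, (D.filter (· ⊆ J)).Nonempty →
      2 ≤ #J ∧ (#(D.filter (· ⊆ J)) + 1 : ℝ) ≤ a * (#J - 1)) {n m : ℕ} (hn : 3 ≤ n)
    (hm : 4 * Fintype.card V * (2 ^ (Fintype.card V + 1) * (17 * Fintype.card V) ^ (#D + 1)) *
      Real.log n ^ a < m) :
    ∃ (L : ℕ) (f : Fin L → Fin n → V) (χ : Finset (Fin n) → Fin L),
      ∀ S : Finset (Fin n), #S = m → ∃ (i : Fin L) (g : V → Fin n),
        (∀ x, g x ∈ S ∧ f i (g x) = x) ∧ ∀ z ∈ D, χ (z.image g) = i := by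
  set v := Fintype.card V with hv
  have hv1 : (1 : ℝ) ≤ v := by exact_mod_cast (Fintype.card_pos : 0 < Fintype.card V)
  have hv0 : (0 : ℝ) < v := by linarith
  set ℓ := Real.log n with hℓ
  have hn0 : (0 : ℝ) < n := by positivity
  have hℓ1 : 1 ≤ ℓ := by
    rw [hℓ, Real.le_log_iff_exp_le hn0]
    have h3 : (3 : ℝ) ≤ n := by exact_mod_cast hn
    linarith [Real.exp_one_lt_d9]
  have hnexp : ∀ j : ℕ, (n : ℝ) ^ j = Real.exp (j * ℓ) := fun j => by
    rw [Real.exp_nat_mul, hℓ, Real.exp_log hn0]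
  -- `m ≥ 4 * v * K * (log n) ^ a` makes the classes of a balanced map of size `k ≥ K * (log n) ^ a`.
  set K : ℝ := 2 ^ (v + 1) * (17 * v) ^ (#D + 1) with hK
  have ha0 : 0 ≤ a := by
    obtain ⟨h1, h2⟩ := ha univ (by simpa using hD)
    have h3 : (2 : ℝ) ≤ #(univ : Finset V) := by exact_mod_cast h1
    by_contra! h
    nlinarith [Nat.cast_nonneg (α := ℝ) #(D.filter (· ⊆ univ))]
  have hℓa : 1 ≤ ℓ ^ a := Real.one_le_rpow hℓ1 ha0
  have hKv : 2 * (v : ℝ) ≤ K := by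
    have h1 : (1 : ℝ) ≤ 2 ^ (v + 1) := one_le_pow₀ one_le_two
    have h2 : 17 * (v : ℝ) ≤ (17 * v) ^ (#D + 1) :=
      le_self_pow₀ (by linarith) (Nat.succ_ne_zero _)
    nlinarith
  have hK1 : 1 ≤ K := by linarith
  set L := ⌈16 * v * ℓ⌉₊ with hL
  have hLlow : 16 * v * ℓ ≤ L := Nat.le_ceil _
  have hvℓ : 1 ≤ v * ℓ := one_le_mul_of_one_le_of_one_le hv1 hℓ1
  have hLup : (L : ℝ) ≤ 17 * v * ℓ := by
    have := Nat.ceil_lt_add_one (show 0 ≤ 16 * v * ℓ by positivity)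
    rw [← hL] at this
    linarith
  have hL0' : (0 : ℝ) < L := by linarith
  have hL0 : 0 < L := by exact_mod_cast hL0'
  have hL1 : (1 : ℝ) ≤ L := by exact_mod_cast hL0
  have hmK : 4 * v * K ≤ m := by
    refine le_trans (le_mul_of_one_le_right (by positivity) hℓa) hm.le
  have hm0 : (0 : ℝ) < m := lt_of_lt_of_le (by positivity) hmK
  set k := ⌈(m / (4 * v) : ℝ)⌉₊ with hk
  have hklow : m / (4 * v) ≤ (k : ℝ) := Nat.le_ceil _
  have hk0 : (0 : ℝ) < k := lt_of_lt_of_le (by positivity) hklow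
  have hkK : K * ℓ ^ a ≤ k := by
    refine le_trans ?_ hklow
    rw [le_div_iff₀ (by positivity)]
    linarith
  have hkL : 4 * (m * ℓ) ≤ k * L := by
    calc 4 * (m * ℓ) = m / (4 * v) * (16 * v * ℓ) := by field_simp; ring
      _ ≤ k * L := by gcongr
  have hmℓ : 0 < m * ℓ := by positivity
  obtain ⟨f, hf⟩ := exists_balanced_maps (U := Fin n) (V := V) (m := m) (L := L) (by
    have hfac : v * Real.exp (-(m / (4 * v))) ≤ Real.exp (-(m / (8 * v))) := by
      have h1 : (v : ℝ) ≤ m / (8 * v) := by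
        rw [le_div_iff₀ (by positivity)]
        nlinarith
      have h2 : (v : ℝ) ≤ Real.exp (m / (8 * v)) := by
        linarith [Real.add_one_le_exp ((m : ℝ) / (8 * v))]
      calc v * Real.exp (-(m / (4 * v)))
          ≤ Real.exp (m / (8 * v)) * Real.exp (-(m / (4 * v))) := by gcongr
        _ = _ := by rw [← Real.exp_add]; congr 1; field_simp; ring
    have hL2 : 2 * (m * ℓ) ≤ L * (m / (8 * v)) := by
      calc 2 * (m * ℓ) = (16 * v * ℓ) * (m / (8 * v)) := by field_simp; ring
        _ ≤ _ := by gcongr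
    rw [Fintype.card_fin, ← hv, hnexp]
    calc Real.exp (m * ℓ) * (v * Real.exp (-(m / (4 * v)))) ^ L
        ≤ Real.exp (m * ℓ) * Real.exp (-(m / (8 * v))) ^ L := by gcongr
      _ = Real.exp (m * ℓ + L * -(m / (8 * v))) := by rw [← Real.exp_nat_mul, Real.exp_add]
      _ < 1 := by rw [Real.exp_lt_one_iff]; linarith)
  have : Nonempty (Fin L) := ⟨⟨0, hL0⟩⟩
  choose! i hi using hf
  have hT : ∀ S : Finset (Fin n), #S = m → ∃ T : V → Finset (Fin n), ∀ x,
      T x ⊆ S.filter (fun u => f (i S) u = x) ∧ #(T x) = k := by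
    intro S hS
    have h : ∀ x, ∃ T ⊆ S.filter (fun u => f (i S) u = x), #T = k := fun x => by
      refine exists_subset_card_eq (Nat.ceil_le.2 ?_)
      rw [div_le_iff₀ (by positivity)]
      have := hi S hS x
      rw [mul_comm]
      exact_mod_cast this
    choose T hT using h
    exact ⟨T, hT⟩
  choose! T hT using hT
  -- `B` is large enough that `exp (-(B / 2 ^ (v + 2))) ≤ n ^ (-2 * m)` beats the number of `m`-sets.
  set B : ℝ := 2 ^ (v + 1) * k * L with hB
  have hBJ : ∀ J : Finset V, (D.filter (· ⊆ J)).Nonempty →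
      B ≤ (k : ℝ) ^ #J * (1 / L : ℝ) ^ #(D.filter (· ⊆ J)) := by
    intro J hJ
    obtain ⟨hJ2, hJa⟩ := ha J hJ
    set e := #(D.filter (· ⊆ J)) with he
    have heD : e ≤ #D := card_filter_le _ _
    obtain ⟨j, hj⟩ := Nat.exists_eq_add_of_le' (show 1 ≤ #J by omega)
    have hj1 : j ≠ 0 := by omega
    rw [hj] at hJa ⊢
    -- The factor `k` of `B` lowers `#J` by one and the factor `L` raises the number of pairs by one:
    -- the exponent `a` is exactly what this comparison needs.
    have hpow : 2 ^ (v + 1) * (L : ℝ) ^ (e + 1) ≤ (k : ℝ) ^ j := by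
      calc 2 ^ (v + 1) * (L : ℝ) ^ (e + 1) ≤ 2 ^ (v + 1) * (17 * v * ℓ) ^ (e + 1) := by gcongr
        _ = 2 ^ (v + 1) * (17 * v) ^ (e + 1) * ℓ ^ (e + 1) := by rw [mul_pow _ ℓ, mul_assoc]
        _ ≤ K * ℓ ^ (e + 1) := by
            rw [hK]; gcongr; linarith
        _ ≤ K ^ j * (ℓ ^ a) ^ j := by
            refine mul_le_mul (le_self_pow₀ hK1 hj1) ?_ (by positivity) (by positivity)
            rw [← Real.rpow_natCast, ← Real.rpow_natCast, ← Real.rpow_mul (by linarith)]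
            refine Real.rpow_le_rpow_of_exponent_le hℓ1 ?_
            push_cast at hJa ⊢
            linarith
        _ ≤ (k : ℝ) ^ j := by
            rw [← mul_pow]; gcongr
    rw [one_div, inv_pow, ← div_eq_mul_inv, le_div_iff₀ (by positivity), hB]
    calc 2 ^ (v + 1) * (k : ℝ) * L * L ^ e = 2 ^ (v + 1) * (L : ℝ) ^ (e + 1) * k := by ring
      _ ≤ (k : ℝ) ^ j * k := by gcongr
      _ = (k : ℝ) ^ (j + 1) := (pow_succ _ _).symm
  obtain ⟨χ, hχ⟩ := exists_coloring_of_unionBound (ι := Finset (Fin n)) hL0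
    (powersetCard m (univ : Finset (Fin n))) i
    (fun S R => ∀ g ∈ Fintype.piFinset (T S), ¬ D.image (image g) ⊆ R)
    (ε := Real.exp (-(B / 2 ^ (v + 2)))) (by
      have hchoose : (#(powersetCard m (univ : Finset (Fin n))) : ℝ) ≤ Real.exp (m * ℓ) := by
        rw [card_powersetCard, card_univ, Fintype.card_fin, ← hnexp]
        exact_mod_cast Nat.choose_le_pow _ _
      have hBe : B / 2 ^ (v + 2) = k * L / 2 := by
        rw [hB]; field_simp; ring
      rw [hBe]
      calc _ ≤ Real.exp (m * ℓ) * Real.exp (-(k * L / 2)) := by gcongr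
        _ = Real.exp (m * ℓ + -(k * L / 2)) := (Real.exp_add _ _).symm
        _ < 1 := by rw [Real.exp_lt_one_iff]; linarith)
    (fun S hS => sum_bernoulliWeight_no_transversal_le
      (fun x => (hT S (mem_powersetCard.1 hS).2 x).2)
      (fun x u hu => (mem_filter.1 ((hT S (mem_powersetCard.1 hS).2 x).1 hu)).2) hD
      (by positivity) (by rw [div_le_one hL0']; exact hL1) (by positivity) hBJ)
  refine ⟨L, f, χ, fun S hS => ⟨i S, ?_⟩⟩
  have h := hχ S (mem_powersetCard.2 ⟨subset_univ _, hS⟩)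
  push Not at h
  obtain ⟨g, hg, hgD⟩ := h
  refine ⟨g, fun x => ?_, fun z hz => ?_⟩
  · have := (hT S hS x).1 (Fintype.mem_piFinset.1 hg x)
    exact mem_filter.1 this
  · exact (mem_filter.1 (hgD (mem_image_of_mem _ hz))).2

end ProbabilisticChoice

/-! ### The hypergraph of a colouring and a family of vertex maps -/

namespace Hypergraph

variable {α U ι : Type*}

/-- The `r`-graph on `U` given by maps `f i : U → α` and a colouring `χ`: an `r`-set is an edge if
all its pairs have one common colour `i` and `f i` maps it onto an edge of `F`. For simplicity `χ`
colours all finite subsets of `U`, although only the colours of pairs matter. -/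
def ofColoring [DecidableEq U] (r : ℕ) (F : Hypergraph α) (f : ι → U → α) (χ : Finset U → ι) :
    Hypergraph U where
  vertexSet := Set.univ
  edgeSet := {e | e.ncard = r ∧ ∃ i, (∀ u ∈ e, ∀ w ∈ e, u ≠ w → χ {u, w} = i) ∧ f i '' e ∈ E(F)}
  subset_vertexSet_of_mem_edgeSet' := fun _ _ => Set.subset_univ _

/-- In a copy of `G`, edges sharing two vertices have the same colour, so by tight connectivity all
edges have one colour `i`, and `f i` is then a homomorphism to `F`. -/
lemma isFree_ofColoring {β : Type*} [DecidableEq U] {r : ℕ} {F : Hypergraph α} {f : ι → U → α}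
    (hf : ∀ i u, f i u ∈ V(F)) (hF : V(F).Nonempty) (χ : Finset U → ι) {G : Hypergraph β}
    (hG : G.IsTightlyConnected 2) (hGF : ¬ G.IsHomomorphicTo F) :
    (ofColoring r F f χ).IsFree G := by
  rintro ⟨φ, hφ, -, hE⟩
  obtain ⟨t, e, -, hrange, htight⟩ := hG
  have heG : ∀ a, e a ∈ E(G) := fun a => hrange ▸ Set.mem_range_self a
  have hedge : ∀ a, ∃ i, (∀ u ∈ φ '' e a, ∀ w ∈ φ '' e a, u ≠ w → χ {u, w} = i) ∧
      f i '' (φ '' e a) ∈ E(F) := fun a => (hE ⟨e a, heG a, rfl⟩).2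
  choose c hc hcF using hedge
  have hcol : ∀ (a : ℕ) (ha : a < t), c ⟨a, ha⟩ = c ⟨0, by omega⟩ := by
    intro a
    induction a using Nat.strong_induction_on with
    | _ a ih =>
      intro ha
      rcases Nat.eq_zero_or_pos a with rfl | hpos
      · rfl
      · obtain ⟨b, hb, hcard⟩ := htight ⟨a, ha⟩ hpos
        rw [← ih b hb b.2]
        obtain ⟨x, hx, y, hy, hxy⟩ := (Set.one_lt_ncard
          (Set.finite_of_ncard_pos (by omega))).1 (show 1 < (e ⟨a, ha⟩ ∩ e b).ncard by omega)
        have hne : φ x ≠ φ y := fun h => hxy (hφ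
          (G.subset_vertexSet_of_mem_edgeSet (heG b) hx.2)
          (G.subset_vertexSet_of_mem_edgeSet (heG b) hy.2) h)
        rw [← hc ⟨a, ha⟩ _ ⟨x, hx.1, rfl⟩ _ ⟨y, hy.1, rfl⟩ hne,
          ← hc b _ ⟨x, hx.2, rfl⟩ _ ⟨y, hy.2, rfl⟩ hne]
  rcases Nat.eq_zero_or_pos t with rfl | ht
  · obtain ⟨x, hx⟩ := hF
    refine hGF ⟨fun _ => x, fun _ _ => hx, fun y hy => ?_⟩
    obtain ⟨a, -⟩ := hrange.symm ▸ hy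
    exact a.elim0
  · refine hGF ⟨f (c ⟨0, ht⟩) ∘ φ, fun _ _ => hf _ _, fun y hy => ?_⟩
    obtain ⟨a, rfl⟩ := hrange.symm ▸ hy
    rw [Set.image_comp, ← hcol a a.2]
    exact hcF a

/-- A section `g` of `f i` over `V(F)` with values in `S` that sends the pairs in edges of `F` to
pairs of colour `i` embeds `F`. -/
lemma containsCopy_induce_ofColoring [DecidableEq U] {r : ℕ} {F : Hypergraph α}
    (hF : F.IsRGraph r) {f : ι → U → α} {χ : Finset U → ι} {S : Set U} {i : ι} {g : α → U}
    (hgS : ∀ x ∈ V(F), g x ∈ S) (hg : ∀ x ∈ V(F), f i (g x) = x)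
    (hχ : ∀ e ∈ E(F), ∀ x ∈ e, ∀ y ∈ e, x ≠ y → χ {g x, g y} = i) :
    ((ofColoring r F f χ).induce S).ContainsCopy F := by
  have hinj : Set.InjOn g V(F) := fun x hx y hy h => by rw [← hg x hx, h, hg y hy]
  refine ⟨g, hinj, ?_, ?_⟩
  · rintro _ ⟨x, hx, rfl⟩
    exact ⟨trivial, hgS x hx⟩
  · rintro _ ⟨e, he, rfl⟩
    have heV : e ⊆ V(F) := F.subset_vertexSet_of_mem_edgeSet he
    refine ⟨⟨?_, i, ?_, ?_⟩, ?_⟩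
    · rw [(hinj.mono heV).ncard_image, hF.ncard_edge e he]
    · rintro _ ⟨x, hx, rfl⟩ _ ⟨y, hy, rfl⟩ hxy
      exact hχ e he x hx y hy fun h => hxy (h ▸ rfl)
    · rw [Set.image_image, Set.image_congr fun x hx => hg x (heV hx), Set.image_id']
      exact he
    · rintro _ ⟨x, hx, rfl⟩
      exact hgS x (heV hx)

/-- The bound `(e(F') + 1) / (v(F') - 1) ≤ α_F` for the subgraph `F'` of `∂₂ F` induced on `J`. -/
lemma two_le_card_and_le_alpha {r : ℕ} (hr : 2 ≤ r) {F : Hypergraph α} (hF : F.IsRGraph r)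
    (hFE : E(F).Nonempty) {D : Finset (Finset V(F))}
    (hD : ∀ z ∈ D, ((↑) '' (z : Set V(F)) : Set α) ∈ E(F.kShadow 2)) (J : Finset V(F))
    {D' : Finset (Finset V(F))} (hD' : D' ⊆ D) (hJ : ∀ z ∈ D', z ⊆ J) (hne : D'.Nonempty) :
    2 ≤ J.card ∧ (D'.card + 1 : ℝ) ≤ F.alpha * (J.card - 1) := by
  have hinj : Function.Injective fun z : Finset V(F) => ((↑) '' (z : Set V(F)) : Set α) :=
    (Set.image_injective.2 Subtype.val_injective).comp Finset.coe_injective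
  have h2 : 2 ≤ J.card := by
    obtain ⟨z, hz⟩ := hne
    obtain ⟨-, -, -, hc⟩ := hD z (hD' hz)
    rw [Set.ncard_image_of_injective _ Subtype.val_injective, Set.ncard_coe_finset] at hc
    exact hc ▸ Finset.card_le_card (hJ z hz)
  refine ⟨h2, ?_⟩
  let F' : Hypergraph α :=
    { vertexSet := (↑) '' (J : Set V(F))
      edgeSet := (fun z : Finset V(F) => ((↑) '' (z : Set V(F)) : Set α)) '' D'
      subset_vertexSet_of_mem_edgeSet' := by
        rintro _ ⟨z, hz, rfl⟩
        exact Set.image_mono (Finset.coe_subset.2 (hJ z hz)) }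
  have hmem : ((D'.card : ℝ) + 1) / ((J.card : ℝ) - 1) ∈ F.densityValues := by
    refine ⟨F', ⟨?_, ?_⟩, hne.to_set.image _, ?_⟩
    · rintro _ ⟨x, -, rfl⟩
      exact x.2
    · rintro _ ⟨z, hz, rfl⟩
      exact hD z (hD' hz)
    · rw [Set.ncard_image_of_injective _ hinj, Set.ncard_coe_finset,
        Set.ncard_image_of_injective _ Subtype.val_injective, Set.ncard_coe_finset]
  have hle := (isGreatest_alpha hr hF hFE).2 hmem
  have h2' : (2 : ℝ) ≤ J.card := by exact_mod_cast h2
  rwa [div_le_iff₀ (by linarith)] at hle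

end Hypergraph

/-! ### The upper bound for the Erdős–Rogers function -/

theorem theorem1p3 (r : ℕ) (hr : 3 ≤ r) {α : Type u} (F : Hypergraph α)
    (hF : F.IsRGraph r) (hFE : F.edgeSet.Nonempty) :
    ∃ c : ℝ, ∀ (β : Type v) (G : Hypergraph β), G.IsRGraph r → G.IsTightlyConnected 2 →
      ¬ G.IsHomomorphicTo F →
        ∀ᶠ n : ℕ in Filter.atTop,
          (Hypergraph.erdosRogers r F G n : ℝ) ≤ c * Real.log n ^ F.alpha := by
  classical
  have : Fintype F.vertexSet := hF.finite_vertexSet.fintype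
  set D : Finset (Finset F.vertexSet) := Finset.univ.filter fun z =>
    ((↑) '' (z : Set F.vertexSet) : Set α) ∈ (F.kShadow 2).edgeSet with hD
  have hpair : ∀ e ∈ F.edgeSet, ∀ x y : F.vertexSet, x.1 ∈ e → y.1 ∈ e → x ≠ y →
      ({x, y} : Finset F.vertexSet) ∈ D := by
    intro e he x y hx hy hxy
    refine Finset.mem_filter.2 ⟨Finset.mem_univ _, e, he, ?_, ?_⟩
    · simp [Set.insert_subset_iff, Set.image_insert_eq, hx, hy]
    · rw [Set.ncard_image_of_injective _ Subtype.val_injective, Set.ncard_coe_finset,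
        Finset.card_pair hxy]
  obtain ⟨e₀, he₀⟩ := id hFE
  have he₀V := F.subset_vertexSet_of_mem_edgeSet he₀
  have hcard : 1 < e₀.ncard := by rw [hF.ncard_edge e₀ he₀]; omega
  obtain ⟨x₀, hx₀, y₀, hy₀, hxy₀⟩ :=
    (Set.one_lt_ncard (Set.finite_of_ncard_pos (by omega))).1 hcard
  have : Nonempty F.vertexSet := ⟨⟨x₀, he₀V hx₀⟩⟩
  have hDne : D.Nonempty := ⟨_, hpair e₀ he₀ ⟨x₀, he₀V hx₀⟩ ⟨y₀, he₀V hy₀⟩ hx₀ hy₀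
    fun h => hxy₀ (congrArg Subtype.val h)⟩
  refine ⟨4 * Fintype.card F.vertexSet * (2 ^ (Fintype.card F.vertexSet + 1) *
    (17 * Fintype.card F.vertexSet) ^ (D.card + 1)), fun β G _ hG hGF => ?_⟩
  filter_upwards [Filter.eventually_ge_atTop 3] with n hn
  by_contra! hlt
  obtain ⟨L, f, χ, hχ⟩ := exists_maps_coloring hDne
    (fun J hJ => Hypergraph.two_le_card_and_le_alpha (by omega) hF hFE
      (fun z hz => (Finset.mem_filter.1 hz).2) J (Finset.filter_subset _ _)
      (fun z hz => (Finset.mem_filter.1 hz).2) hJ) hn hlt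
  have hmem := (Hypergraph.isGreatest_erdosRogers (by omega) hF hFE hGF n).1
  obtain ⟨S, hS, hfree⟩ := hmem
    (Hypergraph.ofColoring r F (fun i u => (f i u : α)) χ) rfl
    ⟨Set.toFinite _, fun e he => he.1⟩
    (Hypergraph.isFree_ofColoring (fun i u => (f i u).2) ⟨x₀, he₀V hx₀⟩ χ hG hGF)
  obtain ⟨i, g, hg, hgD⟩ := hχ S.toFinset (by rw [← hS, Set.ncard_eq_toFinset_card'])
  -- Off `V(F)` the values of `g'` are irrelevant.
  set g' : α → Fin n := Function.extend Subtype.val g fun _ => g ⟨x₀, he₀V hx₀⟩ with hg'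
  have hext : ∀ (x : α) (hx : x ∈ F.vertexSet), g' x = g ⟨x, hx⟩ := fun x hx =>
    Subtype.val_injective.extend_apply g _ ⟨x, hx⟩
  refine hfree (Hypergraph.containsCopy_induce_ofColoring hF (i := i) (g := g') ?_ ?_ ?_)
  · intro x hx
    rw [hext x hx]
    exact Set.mem_toFinset.1 (hg _).1
  · intro x hx
    rw [hext x hx, (hg _).2]
  · intro e he x hx y hy hxy
    have heV := F.subset_vertexSet_of_mem_edgeSet he
    rw [hext x (heV hx), hext y (heV hy)]
    have h := hgD _ (hpair e he ⟨x, heV hx⟩ ⟨y, heV hy⟩ hx hy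
      fun h => hxy (congrArg Subtype.val h))
    rwa [Finset.image_insert, Finset.image_singleton] at h
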